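/- Let $a,b\in\mathbb Z$ and let $m$ be an integer with $0\le m\le 5$. Suppose that $x^6+ax^m+b\in\mathbb Z[x]$ is irreducible and let $K=\mathbb Q(\theta)$ be the sextic number field generated by a root $\theta$ of this polynomial. Let $\mathbb Z_K$ be the ring of integers of $K$, and let the index $i(K)$ of $K$ be the greatest common divisor of the indices $(\mathbb Z_K:\mathbb Z[\eta])$, where $\eta$ runs over all elements of $\mathbb Z_K$ with $K=\mathbb Q(\eta)$. Then the following hold. 1. If $a\equiv 0 \pmod 9$ and $b\equiv -1 \pmod 9$, then $3$ divides $i(K)$. 2. If $a\equiv 0 \pmod 8$ and $b\equiv -1 \pmod 4$, then $2$ divides $i(K)$. In particular, if $a$ and $b$ satisfy the congruences in 1 or those in 2, then $K$ is not monogenic, that is, there is no $\alpha\in\mathbb Z_K$ such that $(1,\alpha,\ldots,\alpha^5)$ is a $\mathbb Z$-basis of $\mathbb Z_K$. -/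

import Mathlib

open Polynomial NumberField IntermediateField

namespace NumberField

/-- The index `(𝓞 K : ℤ[θ])` of an algebraic integer `θ` of `K`, as the index of the additive
subgroup underlying `ℤ[θ]` (it is finite as soon as `θ` generates `K` over `ℚ`). -/
noncomputable def elementIndex (K : Type*) [Field K] [NumberField K] (θ : 𝓞 K) : ℕ :=
  (Subalgebra.toSubmodule (Algebra.adjoin ℤ {θ})).toAddSubgroup.index

/-- The set of all indices `(𝓞 K : ℤ[θ])` with `θ ∈ 𝓞 K` and `K = ℚ(θ)`. -/
def elementIndices (K : Type*) [Field K] [NumberField K] : Set ℕ :=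
  {d | ∃ θ : 𝓞 K, ℚ⟮(θ : K)⟯ = ⊤ ∧ d = elementIndex K θ}

/-- The index `i(K)` of a number field `K`: the greatest common divisor of all `(𝓞 K : ℤ[θ])`
with `θ ∈ 𝓞 K` and `K = ℚ(θ)`. The gcd of a possibly infinite set of integers is taken as the
nonnegative generator of the ideal of `ℤ` spanned by it. -/
noncomputable def fieldIndex (K : Type*) [Field K] [NumberField K] : ℕ :=
  (Submodule.IsPrincipal.generator
    (Ideal.span ((fun d : ℕ => (d : ℤ)) '' elementIndices K))).natAbs

/-- The universal property of the gcd for `i(K)`. -/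
theorem dvd_fieldIndex_iff (K : Type*) [Field K] [NumberField K] (d : ℕ) :
    d ∣ fieldIndex K ↔ ∀ θ : 𝓞 K, ℚ⟮(θ : K)⟯ = ⊤ → d ∣ elementIndex K θ := by
  unfold fieldIndex
  rw [← Int.natCast_dvd, ← Ideal.mem_span_singleton, ← Ideal.span_singleton_le_iff_mem,
    Ideal.span_singleton_generator, Ideal.span_le]
  constructor
  · intro h θ hθ
    exact Int.natCast_dvd_natCast.1 (Ideal.mem_span_singleton.1 (h ⟨_, ⟨θ, hθ, rfl⟩, rfl⟩))
  · rintro h _ ⟨_, ⟨θ, hθ, rfl⟩, rfl⟩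
    exact Ideal.mem_span_singleton.2 (Int.natCast_dvd_natCast.2 (h θ hθ))

/-- `K`, of degree `n`, is monogenic if `𝓞 K` has a `ℤ`-basis `(1, α, …, α ^ (n - 1))` for some
`α ∈ 𝓞 K`. -/
def IsMonogenic (K : Type*) [Field K] [NumberField K] : Prop :=
  ∃ (α : 𝓞 K) (B : Module.Basis (Fin (Module.finrank ℚ K)) ℤ (𝓞 K)),
    ∀ i, B i = α ^ (i : ℕ)

end NumberField

/-!
Let `O = 𝓞 K`, a free `ℤ`-module of rank `6`, and let `p` be `2` or `3`. If `p` does not divide the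
index of `ℤ[η]` in `O`, then `O = ℤ[η] + p O`, so the `𝔽_p`-algebra `O / p O`, of dimension `6`, is
generated by the class of `η`. This is contradicted by exhibiting equations that hold for *every*
element of `O / p O`.

* For `p = 2`, the element `γ = (θ ^ 3 - 1) / 2` is integral, and `t ^ 4 - t ∈ 2 A` for all `t` in
  `A = ℤ[θ, γ]`, since this holds for the generators and is inherited by sums and products. Hence
  `A / 2 A` is reduced. As `2 x ∈ A` with `x ∈ O` is nilpotent modulo `2 A`, it lies in `2 A`; that
  is, `O / A` has no `2`-torsion and `O = A + 2 O`. So `η ^ 4 - η ∈ 2 O`, and `1, η, η ^ 2, η ^ 3`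
  span `O / 2 O`: the rank would be at most `4` (`finrank_le_four_of_two`).

* For `p = 3`, put `w = θ ^ 2 - 1`. The element `δ = w ^ 2 / 3` is integral. In `A = ℤ[θ, δ]` all
  `t` satisfy `t ^ 3 - t ∈ (3, w)`, and `(3, w) / 3` is spanned by `w` and `w θ`. Again `O / A` has
  no `3`-torsion (`mem_of_three_mul_mem`), although `A / 3 A` is not reduced: an element `3 x ∈ A`
  is congruent to `w (c + d θ)` modulo `3 A`, and dividing by `3` and squaring gives
  `δ (c + d θ) ^ 2 ∈ (3, w)`. This forces `3 ∣ c` and `3 ∣ d`, because the six monomials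
  `1, θ, w, w θ, δ, θ δ` span `A` modulo `3` and `A` has rank `6`. It follows that
  `η ^ 3 - η ∈ (3, w) O`, and `1, η, η ^ 2, w, w θ` span `O / 3 O`: the rank would be at most `5`
  (`finrank_le_five_of_three`).

The bounds on the rank come from Nakayama's lemma over `ℤ` (`finrank_le_of_le_spanMod`).
-/

/-! ### Spanning families of an order modulo a prime -/

section
variable {R : Type*} [CommRing R]

/-- An additive group stable under multiplication by the generators of a ring is stable under the
ring. -/
theorem Algebra.mul_mem_of_mem_adjoin {S : Set R} {M : Submodule ℤ R}
    (hM : ∀ s ∈ S, ∀ y ∈ M, s * y ∈ M) {x : R} (hx : x ∈ Algebra.adjoin ℤ S) :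
    ∀ y ∈ M, x * y ∈ M := by
  induction hx using Algebra.adjoin_induction with
  | mem s hs => exact hM s hs
  | algebraMap n =>
    intro y hy
    rw [← Algebra.smul_def]
    exact M.smul_mem n hy
  | add a b _ _ ha hb =>
    intro y hy
    rw [add_mul]
    exact M.add_mem (ha y hy) (hb y hy)
  | mul a b _ _ ha hb =>
    intro y hy
    rw [mul_assoc]
    exact ha _ (hb y hy)

open scoped Pointwise in
theorem Subalgebra.mem_smul_toSubmodule {A : Subalgebra ℤ R} {p : ℤ} {x : R} :
    x ∈ p • Subalgebra.toSubmodule A ↔ ∃ y ∈ A, x = p * y := by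
  rw [Submodule.mem_smul_pointwise_iff_exists]
  simp only [Subalgebra.mem_toSubmodule, zsmul_eq_mul]
  exact ⟨fun ⟨y, hy, h⟩ => ⟨y, hy, h.symm⟩, fun ⟨y, hy, h⟩ => ⟨y, hy, h.symm⟩⟩

open scoped Pointwise in
/-- The additive group `∑ ℤ v i + p A`. The `v i` may lie outside `A`; the family `v` spans `A`
modulo `p A` when `A ≤ spanMod p A v`. -/
noncomputable def spanMod {ι : Type*} (p : ℤ) (A : Subalgebra ℤ R) (v : ι → R) : Submodule ℤ R :=
  Submodule.span ℤ (Set.range v) ⊔ p • Subalgebra.toSubmodule A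

theorem apply_mem_spanMod {ι : Type*} (p : ℤ) (A : Subalgebra ℤ R) (v : ι → R) (i : ι) :
    v i ∈ spanMod p A v :=
  Submodule.mem_sup_left (Submodule.subset_span ⟨i, rfl⟩)

theorem mul_mem_spanMod {ι : Type*} (p : ℤ) (A : Subalgebra ℤ R) (v : ι → R) {x : R} (hx : x ∈ A) :
    (p : R) * x ∈ spanMod p A v :=
  Submodule.mem_sup_right (Subalgebra.mem_smul_toSubmodule.2 ⟨x, hx, rfl⟩)

theorem spanMod_le {ι : Type*} {p : ℤ} {A : Subalgebra ℤ R} {v : ι → R} {M : Submodule ℤ R}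
    (hv : ∀ i, v i ∈ M) (hA : ∀ x ∈ A, (p : R) * x ∈ M) : spanMod p A v ≤ M := by
  refine sup_le (Submodule.span_le.2 ?_) ?_
  · rintro _ ⟨i, rfl⟩
    exact hv i
  · intro x hx
    obtain ⟨y, hy, rfl⟩ := Subalgebra.mem_smul_toSubmodule.1 hx
    exact hA y hy

theorem mul_mem_spanMod_of_forall {ι : Type*} {p : ℤ} {A : Subalgebra ℤ R} {v : ι → R} {s : R}
    (hs : s ∈ A) (h : ∀ i, s * v i ∈ spanMod p A v) :
    ∀ y ∈ spanMod p A v, s * y ∈ spanMod p A v := by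
  have : spanMod p A v ≤ (spanMod p A v).comap (LinearMap.mulLeft ℤ s) := by
    refine spanMod_le h fun x hx => ?_
    have := mul_mem_spanMod p A v (A.mul_mem hs hx)
    simpa [mul_left_comm] using this
  exact fun y hy => this hy

/-- If `A` has finite exponent in `R`, so that `A` and `R` have the same rank, and `k` elements span
`A` modulo `p A`, then the rank is at most `k`: by Nakayama, some integer `r ≡ 1` modulo `p`
multiplies `A` into the `ℤ`-span of these elements. -/
theorem finrank_le_of_le_spanMod [IsDomain R] [CharZero R] [Module.Finite ℤ R]
    {p : ℕ} (hp : p.Prime) {A : Subalgebra ℤ R} {n : ℤ} (hn : n ≠ 0) (hA : ∀ x : R, (n : R) * x ∈ A)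
    {k : ℕ} {v : Fin k → R} (h : Subalgebra.toSubmodule A ≤ spanMod p A v) :
    Module.finrank ℤ R ≤ k := by
  have hle : Subalgebra.toSubmodule A ≤
      Submodule.span ℤ (Set.range v) ⊔ Ideal.span {(p : ℤ)} • Subalgebra.toSubmodule A := by
    rwa [Submodule.ideal_span_singleton_smul]
  obtain ⟨r, hr, hrA⟩ := Submodule.exists_sub_one_mem_and_smul_le_of_fg_of_le_sup
    (IsNoetherian.noetherian _) le_rfl hle
  have hr0 : r ≠ 0 := by
    rintro rfl
    rw [Ideal.mem_span_singleton, zero_sub, dvd_neg] at hr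
    exact hp.one_lt.ne' (by exact_mod_cast Int.eq_one_of_dvd_one (by positivity) hr)
  have hmem : ∀ x : R, (r * n) • x ∈ Submodule.span ℤ (Set.range v) := fun x => by
    apply hrA
    rw [mul_smul]
    exact Submodule.smul_mem_pointwise_smul _ _ _ (by simpa using hA x)
  let f : R →ₗ[ℤ] Submodule.span ℤ (Set.range v) :=
    (LinearMap.lsmul ℤ R (r * n)).codRestrict _ hmem
  have hf : Function.Injective f := by
    intro x y hxy
    have h : (r * n) • x = (r * n) • y := congrArg Subtype.val hxy
    exact smul_right_injective R (mul_ne_zero hr0 hn) h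
  calc Module.finrank ℤ R ≤ Module.finrank ℤ (Submodule.span ℤ (Set.range v)) :=
        LinearMap.finrank_le_finrank_of_injective hf
    _ ≤ Fintype.card (Fin k) := finrank_range_le_card v
    _ = k := Fintype.card_fin k

/-! ### Elements fixed by Frobenius, and saturation -/

/-- The elements fixed modulo the ideal `I` by the `k`-th iterate of the Frobenius of `R ⧸ I`,
where `p ∈ I`. -/
def Ideal.frobeniusFixed (I : Ideal R) {p : ℕ} (hp : p.Prime) (hpI : (p : R) ∈ I) (k : ℕ) :
    Subring R where
  carrier := {x | x ^ p ^ k - x ∈ I}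
  one_mem' := by simp
  zero_mem' := by simp [hp.ne_zero]
  mul_mem' {x y} hx hy := by
    have h : (x * y) ^ p ^ k - x * y = (x ^ p ^ k - x) * y ^ p ^ k + x * (y ^ p ^ k - y) := by ring
    change (x * y) ^ p ^ k - x * y ∈ I
    rw [h]
    exact I.add_mem (I.mul_mem_right _ hx) (I.mul_mem_left _ hy)
  add_mem' {x y} hx hy := by
    obtain ⟨r, hr⟩ := exists_add_pow_prime_pow_eq hp x y k
    have h : (x + y) ^ p ^ k - (x + y) = (x ^ p ^ k - x) + (y ^ p ^ k - y) + p * (x * y * r) := by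
      rw [hr]; ring
    change (x + y) ^ p ^ k - (x + y) ∈ I
    rw [h]
    exact I.add_mem (I.add_mem hx hy) (I.mul_mem_right _ hpI)
  neg_mem' {x} hx := by
    obtain ⟨r, hr⟩ := exists_add_pow_prime_pow_eq hp x (-x) k
    rw [add_neg_cancel, zero_pow (pow_ne_zero k hp.ne_zero)] at hr
    have h : (-x) ^ p ^ k - (-x) = -(x ^ p ^ k - x) + p * (x * x * r) := by
      linear_combination -hr
    change (-x) ^ p ^ k - (-x) ∈ I
    rw [h]
    exact I.add_mem (I.neg_mem hx) (I.mul_mem_right _ hpI)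

theorem Ideal.mem_frobeniusFixed {I : Ideal R} {p : ℕ} {hp : p.Prime} {hpI : (p : R) ∈ I} {k : ℕ}
    {x : R} : x ∈ I.frobeniusFixed hp hpI k ↔ x ^ p ^ k - x ∈ I := Iff.rfl

theorem Ideal.le_frobeniusFixed {I : Ideal R} {p : ℕ} {hp : p.Prime} {hpI : (p : R) ∈ I} {k : ℕ}
    {x : R} (hx : x ∈ I) : x ∈ I.frobeniusFixed hp hpI k :=
  I.sub_mem (I.pow_mem_of_mem hx _ (pow_pos hp.pos k)) hx

theorem pow_sub_mem_of_mem_adjoin {S : Set R} {I : Ideal R} {p : ℕ} (hp : p.Prime)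
    (hpI : (p : R) ∈ I) {k : ℕ} (hS : ∀ s ∈ S, s ^ p ^ k - s ∈ I) {x : R}
    (hx : x ∈ Algebra.adjoin ℤ S) : x ^ p ^ k - x ∈ I := by
  have h : Algebra.adjoin ℤ S ≤ subalgebraOfSubring (I.frobeniusFixed hp hpI k) :=
    Algebra.adjoin_le hS
  exact h hx

/-- If the Frobenius iterate `t ↦ t ^ p ^ k` fixes the generators of `A = ℤ[S]` modulo the ideal
`(p, w)` of `A`, it fixes all of `A / (p, w)`, so that this ring is reduced. The conclusion is that
an element of `A` with a power in `(p, w)` lies in `(p, w)`. -/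
theorem exists_eq_of_pow_eq {S : Set R} {p : ℕ} (hp : p.Prime) {k : ℕ} (hk : k ≠ 0) {w : R}
    (hw : w ∈ Algebra.adjoin ℤ S)
    (hS : ∀ s ∈ S, ∃ y ∈ Algebra.adjoin ℤ S, ∃ z ∈ Algebra.adjoin ℤ S,
      s ^ p ^ k - s = p * y + w * z)
    {x y z : R} {n : ℕ} (hx : x ∈ Algebra.adjoin ℤ S) (hy : y ∈ Algebra.adjoin ℤ S)
    (hz : z ∈ Algebra.adjoin ℤ S) (h : x ^ n = p * y + w * z) :
    ∃ y ∈ Algebra.adjoin ℤ S, ∃ z ∈ Algebra.adjoin ℤ S, x = p * y + w * z := by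
  set A := Algebra.adjoin ℤ S with hA
  let I : Ideal A := Ideal.span {(p : A), ⟨w, hw⟩}
  have hI : ∀ {t : A}, t ∈ I ↔ ∃ y ∈ A, ∃ z ∈ A, (t : R) = p * y + w * z := by
    intro t
    rw [Ideal.mem_span_pair]
    constructor
    · rintro ⟨u, v, rfl⟩
      exact ⟨u, u.2, v, v.2, by simp [mul_comm]⟩
    · rintro ⟨u, hu, v, hv, h⟩
      exact ⟨⟨u, hu⟩, ⟨v, hv⟩, Subtype.ext (by simp [h, mul_comm])⟩
  have hpI : (p : A) ∈ I := Ideal.subset_span (by simp)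
  have hfix : ∀ t : A, t ^ p ^ k - t ∈ I := by
    rintro ⟨t, ht⟩
    change (⟨t, ht⟩ : A) ∈ I.frobeniusFixed hp hpI k
    induction ht using Algebra.adjoin_induction with
    | mem s hs => exact hI.2 (hS s hs)
    | algebraMap n => exact intCast_mem (I.frobeniusFixed hp hpI k) n
    | add a b ha hb iha ihb => exact add_mem iha ihb
    | mul a b ha hb iha ihb => exact mul_mem iha ihb
  have hrad : I.IsRadical := by
    refine (Ideal.isRadical_iff_pow_one_lt (p ^ k) (Nat.one_lt_pow hk hp.one_lt)).2 fun t ht => ?_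
    simpa using I.sub_mem ht (hfix t)
  exact hI.1 (hrad ⟨n, hI.2 ⟨y, hy, z, hz, by simpa using h⟩⟩ : (⟨x, hx⟩ : A) ∈ I)

theorem exists_eq_add_mul_of_isCoprime {A : Subalgebra ℤ R} {n p : ℤ} (hnp : IsCoprime n p)
    {x : R} (hx : (n : R) * x ∈ A) : ∃ y ∈ A, ∃ z, x = y + p * z := by
  obtain ⟨u, v, huv⟩ := hnp
  refine ⟨u * (n * x), A.mul_mem (intCast_mem A u) hx, v * x, ?_⟩
  have : (u * n + v * p : R) = 1 := by exact_mod_cast congrArg (Int.cast (R := R)) huv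
  linear_combination -x * this

/-- If `A` has finite exponent in `R`, elements of `A ∩ p R` are nilpotent modulo `p A`. -/
theorem exists_pow_eq_prime_mul {A : Subalgebra ℤ R} {n : ℕ} (hn : n ≠ 0)
    (hA : ∀ x : R, (n : R) * x ∈ A) {p : ℕ} (hp : p.Prime) {x : R} (hx : (p : R) * x ∈ A) :
    ∃ k, ∃ y ∈ A, ((p : R) * x) ^ k = p * y := by
  obtain ⟨e, m, hm, rfl⟩ := Nat.exists_eq_pow_mul_and_not_dvd hn p hp.ne_one
  obtain ⟨u, v, huv⟩ := Nat.isCoprime_iff_coprime.2 ((hp.coprime_iff_not_dvd.2 hm).symm)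
  have h : (u * m + v * p : R) = 1 := by exact_mod_cast congrArg (Int.cast (R := R)) huv
  refine ⟨e + 1, u * (((p ^ e * m : ℕ) : R) * x ^ (e + 1)) + v * (p * x) ^ (e + 1),
    A.add_mem (A.mul_mem (intCast_mem A u) (hA _))
      (A.mul_mem (intCast_mem A v) (A.pow_mem hx _)), ?_⟩
  push_cast
  linear_combination -((p : R) * x) ^ (e + 1) * h

/-- If `R / A` has finite exponent and no `p`-torsion, then `R = A + p R`. -/
theorem exists_eq_add_mul_of_saturated {A : Subalgebra ℤ R} {n : ℕ} (hn : n ≠ 0)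
    (hA : ∀ x : R, (n : R) * x ∈ A) {p : ℕ} (hp : p.Prime)
    (hsat : ∀ x : R, (p : R) * x ∈ A → x ∈ A) (x : R) : ∃ y ∈ A, ∃ z, x = y + (p : ℤ) * z := by
  obtain ⟨e, m, hm, rfl⟩ := Nat.exists_eq_pow_mul_and_not_dvd hn p hp.ne_one
  have hpow : ∀ (j : ℕ) (y : R), (p : R) ^ j * y ∈ A → y ∈ A := by
    intro j
    induction j with
    | zero => simp
    | succ j ih =>
      intro y hy
      rw [pow_succ', mul_assoc] at hy
      exact ih y (hsat _ hy)
  refine exists_eq_add_mul_of_isCoprime (n := m)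
    (Nat.isCoprime_iff_coprime.2 ((hp.coprime_iff_not_dvd.2 hm).symm)) (hpow e _ ?_)
  have := hA x
  push_cast at this ⊢
  rwa [← mul_assoc]

theorem mem_spanMod_pair {p : ℤ} {A : Subalgebra ℤ R} {u v x : R} :
    x ∈ spanMod p A ![u, v] ↔ ∃ c d : ℤ, ∃ y ∈ A, x = c * u + d * v + p * y := by
  simp only [spanMod, Submodule.mem_sup, Matrix.range_cons, Matrix.range_empty, Set.union_empty,
    Set.singleton_union, Submodule.mem_span_pair, Subalgebra.mem_smul_toSubmodule, zsmul_eq_mul]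
  constructor
  · rintro ⟨_, ⟨c, d, rfl⟩, _, ⟨y, hy, rfl⟩, rfl⟩
    exact ⟨c, d, y, hy, rfl⟩
  · rintro ⟨c, d, y, hy, rfl⟩
    exact ⟨_, ⟨c, d, rfl⟩, _, ⟨y, hy, rfl⟩, rfl⟩

/-- If `η` generates `R` modulo `p`, a family spans `R / p R` as soon as its span contains `1` and is
stable under multiplication by `η`. -/
theorem finrank_le_of_spanMod_adjoin_singleton [IsDomain R] [CharZero R] [Module.Finite ℤ R]
    {p : ℕ} (hp : p.Prime) {η : R} (hη : ∀ x, ∃ y ∈ Algebra.adjoin ℤ {η}, ∃ z, x = y + (p : ℤ) * z)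
    {k : ℕ} {v : Fin k → R} (h1 : 1 ∈ spanMod p ⊤ v) (h : ∀ i, η * v i ∈ spanMod p ⊤ v) :
    Module.finrank ℤ R ≤ k := by
  refine finrank_le_of_le_spanMod hp one_ne_zero (A := ⊤) (fun _ => Algebra.mem_top) (v := v) ?_
  intro x _
  obtain ⟨y, hy, z, rfl⟩ := hη x
  refine Submodule.add_mem _ ?_ (mul_mem_spanMod _ _ _ Algebra.mem_top)
  have := Algebra.mul_mem_of_mem_adjoin (M := spanMod p ⊤ v) (S := {η}) (by
    rintro _ rfl
    exact mul_mem_spanMod_of_forall Algebra.mem_top h) hy 1 h1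
  rwa [mul_one] at this

/-! ### The prime two -/

/-- Every element of `R / 2 R` is a root of `T ^ 4 - T`, so a single element generates a subring of
dimension at most `4` over `𝔽_2`. -/
theorem finrank_le_four_of_two [IsDomain R] [CharZero R] [Module.Finite ℤ R]
    {θ γ g η : R} {c : ℤ} (hγ : 2 * γ + 1 = θ ^ 3) (hg : g ∈ Algebra.adjoin ℤ {θ})
    (hγ2 : γ ^ 2 = -γ + c + 2 * g) {n : ℕ} (hn : n ≠ 0)
    (hA : ∀ x : R, (n : R) * x ∈ Algebra.adjoin ℤ {θ})
    (hη : ∀ x, ∃ y ∈ Algebra.adjoin ℤ {η}, ∃ z, x = y + (2 : ℤ) * z) :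
    Module.finrank ℤ R ≤ 4 := by
  set A := Algebra.adjoin ℤ {θ, γ} with hAdef
  have hθA : Algebra.adjoin ℤ {θ} ≤ A := Algebra.adjoin_mono (by simp)
  have hθ : θ ∈ A := Algebra.subset_adjoin (by simp)
  have hγA : γ ∈ A := Algebra.subset_adjoin (by simp)
  have hgA : g ∈ A := hθA hg
  have hcA : (c : R) ∈ A := intCast_mem A c
  have hnA : ∀ x : R, (n : R) * x ∈ A := fun x => hθA (hA x)
  obtain ⟨d, hd⟩ : Even (c + c ^ 2) := by
    have := Int.even_mul_succ_self c
    rwa [show c * (c + 1) = c + c ^ 2 by ring] at this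
  have hd' : (c : R) + c ^ 2 = d + d := by exact_mod_cast congrArg (Int.cast (R := R)) hd
  have hgen : ∀ s ∈ ({θ, γ} : Set R), ∃ y ∈ A, s ^ 2 ^ 2 - s = 2 * y := by
    rintro s (rfl | rfl)
    · exact ⟨s * γ, A.mul_mem hθ hγA, by linear_combination -s * hγ⟩
    · refine ⟨-s + d + g + 2 * g ^ 2 - c * s - 2 * (g * s) + 2 * (c * g), ?_, ?_⟩
      · have h2 : (2 : R) ∈ A := ofNat_mem A 2
        have hdA : (d : R) ∈ A := intCast_mem A d
        have h1 := A.mul_mem h2 (A.mul_mem hgA hγA)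
        have h3 := A.mul_mem h2 (A.mul_mem hcA hgA)
        exact A.add_mem (A.sub_mem (A.sub_mem (A.add_mem (A.add_mem (A.add_mem (A.neg_mem hγA)
          hdA) hgA) (A.mul_mem h2 (A.pow_mem hgA 2))) (A.mul_mem hcA hγA)) h1) h3
      · linear_combination (s ^ 2 + (-s + c + 2 * g) + 1) * hγ2 + hd'
  have hsat : ∀ x : R, ((2 : ℕ) : R) * x ∈ A → x ∈ A := by
    intro x hx
    obtain ⟨k, y, hy, hxy⟩ := exists_pow_eq_prime_mul hn hnA Nat.prime_two hx
    obtain ⟨y, hy, z, -, h⟩ := exists_eq_of_pow_eq Nat.prime_two two_ne_zero (w := 0) (z := 0)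
      (zero_mem _) (fun s hs => by
        obtain ⟨y, hy, h⟩ := hgen s hs
        exact ⟨y, hy, 0, zero_mem _, by simpa using h⟩) hx hy (zero_mem _) (by simpa using hxy)
    have : x = y := by simpa using h
    exact this ▸ hy
  have hfix : ∀ x : R, ∃ y, x ^ 2 ^ 2 - x = 2 * y := by
    intro x
    obtain ⟨a, ha, z, rfl⟩ := exists_eq_add_mul_of_saturated hn hnA Nat.prime_two hsat x
    have h2 : ((2 : ℕ) : R) ∈ Ideal.span {(2 : R)} := Ideal.subset_span (by simp)
    refine Ideal.mem_span_singleton.1 (?_ :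
      a + ((2 : ℕ) : ℤ) * z ∈ (Ideal.span {(2 : R)}).frobeniusFixed Nat.prime_two h2 2)
    refine add_mem (pow_sub_mem_of_mem_adjoin Nat.prime_two h2 (fun s hs => ?_) ha)
      (Ideal.le_frobeniusFixed (Ideal.mul_mem_right _ _ (by simp)))
    obtain ⟨y, -, h⟩ := hgen s hs
    exact Ideal.mem_span_singleton.2 ⟨y, h⟩
  refine finrank_le_of_spanMod_adjoin_singleton Nat.prime_two hη (v := ![1, η, η ^ 2, η ^ 3]) ?_ ?_
  · exact apply_mem_spanMod _ _ ![1, η, η ^ 2, η ^ 3] 0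
  · set v := ![1, η, η ^ 2, η ^ 3] with hv
    intro i
    fin_cases i
    · simpa [hv] using apply_mem_spanMod ((2 : ℕ) : ℤ) ⊤ v 1
    · simpa [hv, sq] using apply_mem_spanMod ((2 : ℕ) : ℤ) ⊤ v 2
    · simpa [hv, ← pow_succ'] using apply_mem_spanMod ((2 : ℕ) : ℤ) ⊤ v 3
    · obtain ⟨y, hy⟩ := hfix η
      have h : η * η ^ 3 = η + ((2 : ℕ) : ℤ) * y := by push_cast; linear_combination hy
      simp only [hv, Fin.reduceFinMk, Matrix.cons_val]
      rw [h]
      exact Submodule.add_mem _ (apply_mem_spanMod ((2 : ℕ) : ℤ) ⊤ v 1)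
        (mul_mem_spanMod _ _ _ Algebra.mem_top)

/-! ### The prime three -/

/-- The ideal `(3, w)` of `ℤ[θ, δ]` is spanned modulo `3` by `w` and `w θ`, since `w θ ^ 2 ≡ w` and
`w δ ≡ -w`. -/
theorem mul_mem_spanMod_pair {θ w δ g : R} (hw : w = θ ^ 2 - 1) (hδ : 3 * δ = w ^ 2)
    (hg : g ∈ Algebra.adjoin ℤ {θ, δ}) (hwδ : w * δ = 3 * g - 3 * δ - w) {x : R}
    (hx : x ∈ Algebra.adjoin ℤ {θ, δ}) :
    w * x ∈ spanMod 3 (Algebra.adjoin ℤ {θ, δ}) ![w, w * θ] := by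
  have hθ : θ ∈ Algebra.adjoin ℤ {θ, δ} := Algebra.subset_adjoin (by simp)
  have hδA : δ ∈ Algebra.adjoin ℤ {θ, δ} := Algebra.subset_adjoin (by simp)
  generalize hA : Algebra.adjoin ℤ {θ, δ} = A at *
  have hθs : ∀ y ∈ spanMod 3 A ![w, w * θ], θ * y ∈ spanMod 3 A ![w, w * θ] := by
    refine mul_mem_spanMod_of_forall hθ (Fin.forall_fin_two.2 ⟨?_, ?_⟩)
    · refine mem_spanMod_pair.2 ⟨0, 1, 0, zero_mem _, ?_⟩
      simp [mul_comm]
    · refine mem_spanMod_pair.2 ⟨1, 0, δ, hδA, ?_⟩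
      simp only [Matrix.cons_val]
      push_cast
      linear_combination -w * hw - hδ
  have hδs : ∀ y ∈ spanMod 3 A ![w, w * θ], δ * y ∈ spanMod 3 A ![w, w * θ] := by
    refine mul_mem_spanMod_of_forall hδA (Fin.forall_fin_two.2 ⟨?_, ?_⟩)
    · refine mem_spanMod_pair.2 ⟨-1, 0, g - δ, A.sub_mem hg hδA, ?_⟩
      simp only [Matrix.cons_val]
      push_cast
      linear_combination hwδ
    · refine mem_spanMod_pair.2 ⟨0, -1, (g - δ) * θ, A.mul_mem (A.sub_mem hg hδA) hθ, ?_⟩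
      simp only [Matrix.cons_val]
      push_cast
      linear_combination θ * hwδ
  rw [mul_comm w x]
  refine Algebra.mul_mem_of_mem_adjoin (S := {θ, δ}) ?_ (hA ▸ hx) w
    (apply_mem_spanMod 3 A ![w, w * θ] 0)
  rintro s (rfl | rfl)
  · exact hθs
  · exact hδs

/-- The six monomials `1, θ, w, w θ, δ, θ δ` span `ℤ[θ, δ]` modulo `3`. -/
theorem adjoin_le_of_monomials_mem {θ w δ g : R} (hw : w = θ ^ 2 - 1) (hδ : 3 * δ = w ^ 2)
    (hg : g ∈ Algebra.adjoin ℤ {θ, δ}) (hwδ : w * δ = 3 * g - 3 * δ - w)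
    (hδ2 : δ ^ 2 = -(1 + w) * δ + w * g) {k : ℕ} {v : Fin k → R}
    (h1 : 1 ∈ spanMod 3 (Algebra.adjoin ℤ {θ, δ}) v)
    (h2 : θ ∈ spanMod 3 (Algebra.adjoin ℤ {θ, δ}) v)
    (h3 : w ∈ spanMod 3 (Algebra.adjoin ℤ {θ, δ}) v)
    (h4 : w * θ ∈ spanMod 3 (Algebra.adjoin ℤ {θ, δ}) v)
    (h5 : δ ∈ spanMod 3 (Algebra.adjoin ℤ {θ, δ}) v)
    (h6 : θ * δ ∈ spanMod 3 (Algebra.adjoin ℤ {θ, δ}) v) :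
    Subalgebra.toSubmodule (Algebra.adjoin ℤ {θ, δ}) ≤
      spanMod 3 (Algebra.adjoin ℤ {θ, δ}) v := by
  have hwmul := fun x => mul_mem_spanMod_pair (x := x) hw hδ hg hwδ
  have hθ : θ ∈ Algebra.adjoin ℤ {θ, δ} := Algebra.subset_adjoin (by simp)
  have hδA : δ ∈ Algebra.adjoin ℤ {θ, δ} := Algebra.subset_adjoin (by simp)
  have hadj := fun M => @Algebra.mul_mem_of_mem_adjoin _ _ {θ, δ} M
  generalize Algebra.adjoin ℤ {θ, δ} = A at *
  let v' : Fin 6 → R := ![1, θ, w, w * θ, δ, θ * δ]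
  have hle : spanMod 3 A v' ≤ spanMod 3 A v := by
    refine spanMod_le (fun i => ?_) fun x hx => mul_mem_spanMod _ _ _ hx
    fin_cases i
    exacts [h1, h2, h3, h4, h5, h6]
  refine le_trans (fun x hx => ?_) hle
  have m0 : 1 ∈ spanMod 3 A v' := apply_mem_spanMod 3 A v' 0
  have m1 : θ ∈ spanMod 3 A v' := apply_mem_spanMod 3 A v' 1
  have m2 : w ∈ spanMod 3 A v' := apply_mem_spanMod 3 A v' 2
  have m3 : w * θ ∈ spanMod 3 A v' := apply_mem_spanMod 3 A v' 3
  have m4 : δ ∈ spanMod 3 A v' := apply_mem_spanMod 3 A v' 4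
  have m5 : θ * δ ∈ spanMod 3 A v' := apply_mem_spanMod 3 A v' 5
  have hpair : spanMod 3 A ![w, w * θ] ≤ spanMod 3 A v' :=
    spanMod_le (Fin.forall_fin_two.2 ⟨m2, m3⟩) fun x hx => mul_mem_spanMod _ _ _ hx
  have hwx : ∀ x ∈ A, w * x ∈ spanMod 3 A v' := fun x hx => hpair (hwmul x hx)
  have hδδ : w * (g - δ) - δ ∈ spanMod 3 A v' :=
    Submodule.sub_mem _ (hwx _ (A.sub_mem hg hδA)) m4
  have hθs : ∀ y ∈ spanMod 3 A v', θ * y ∈ spanMod 3 A v' := by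
    refine mul_mem_spanMod_of_forall hθ fun i => ?_
    have e0 : θ * 1 ∈ spanMod 3 A v' := by rwa [mul_one]
    have e1 : θ * θ ∈ spanMod 3 A v' := by
      rw [show θ * θ = 1 + w by rw [hw]; ring]
      exact Submodule.add_mem _ m0 m2
    have e2 : θ * w ∈ spanMod 3 A v' := by rwa [mul_comm]
    have e3 : θ * (w * θ) ∈ spanMod 3 A v' := by
      rw [mul_left_comm]
      exact hwx _ (A.mul_mem hθ hθ)
    have e5 : θ * (θ * δ) ∈ spanMod 3 A v' := by
      rw [show θ * (θ * δ) = δ + w * δ by rw [hw]; ring]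
      exact Submodule.add_mem _ m4 (hwx _ hδA)
    fin_cases i
    exacts [e0, e1, e2, e3, m5, e5]
  have hδs : ∀ y ∈ spanMod 3 A v', δ * y ∈ spanMod 3 A v' := by
    refine mul_mem_spanMod_of_forall hδA fun i => ?_
    have e0 : δ * 1 ∈ spanMod 3 A v' := by rwa [mul_one]
    have e1 : δ * θ ∈ spanMod 3 A v' := by rwa [mul_comm]
    have e2 : δ * w ∈ spanMod 3 A v' := by
      rw [mul_comm]
      exact hwx _ hδA
    have e3 : δ * (w * θ) ∈ spanMod 3 A v' := by
      rw [mul_left_comm]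
      exact hwx _ (A.mul_mem hδA hθ)
    have e4 : δ * δ ∈ spanMod 3 A v' := by
      rwa [show δ * δ = w * (g - δ) - δ by linear_combination hδ2]
    have e5 : δ * (θ * δ) ∈ spanMod 3 A v' := by
      rw [mul_left_comm]
      exact hθs _ e4
    fin_cases i
    exacts [e0, e1, e2, e3, e4, e5]
  have := hadj (spanMod 3 A v') (by
    rintro s (rfl | rfl)
    · exact hθs
    · exact hδs) hx 1 m0
  rwa [mul_one] at this

/-- In rank at least `6` the elements `δ` and `θ δ` are linearly independent modulo `(3, w)`:
otherwise one of them could be dropped from the six monomials that span `ℤ[θ, δ]` modulo `3`. -/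
theorem three_dvd_of_mem_spanMod [IsDomain R] [CharZero R] [Module.Finite ℤ R]
    {θ w δ g : R} (hw : w = θ ^ 2 - 1) (hδ : 3 * δ = w ^ 2)
    (hg : g ∈ Algebra.adjoin ℤ {θ, δ}) (hwδ : w * δ = 3 * g - 3 * δ - w)
    (hδ2 : δ ^ 2 = -(1 + w) * δ + w * g) {n : ℕ} (hn : n ≠ 0)
    (hnA : ∀ x : R, (n : R) * x ∈ Algebra.adjoin ℤ {θ, δ}) (hrank : 5 < Module.finrank ℤ R)
    {e f : ℤ} (hef : e * δ + f * (θ * δ) ∈ spanMod 3 (Algebra.adjoin ℤ {θ, δ}) ![w, w * θ]) :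
    3 ∣ e ∧ 3 ∣ f := by
  by_contra hcon
  have hspan := fun v => @adjoin_le_of_monomials_mem R _ θ w δ g hw hδ hg hwδ hδ2 5 v
  have hrk := fun v => finrank_le_of_le_spanMod Nat.prime_three (v := v) (n := n) (k := 5)
      (by exact_mod_cast hn) (by exact_mod_cast hnA)
  have hθ : θ ∈ Algebra.adjoin ℤ {θ, δ} := Algebra.subset_adjoin (by simp)
  have hδA : δ ∈ Algebra.adjoin ℤ {θ, δ} := Algebra.subset_adjoin (by simp)
  generalize Algebra.adjoin ℤ {θ, δ} = A at *
  -- the element with coefficient prime to `3` is the one left out: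
  -- the others generate it
  let v : Fin 5 → R := ![1, θ, w, w * θ, if 3 ∣ f then θ * δ else δ]
  refine hrank.not_ge (hrk v ?_)
  have m0 : 1 ∈ spanMod 3 A v := apply_mem_spanMod 3 A v 0
  have m1 : θ ∈ spanMod 3 A v := apply_mem_spanMod 3 A v 1
  have m2 : w ∈ spanMod 3 A v := apply_mem_spanMod 3 A v 2
  have m3 : w * θ ∈ spanMod 3 A v := apply_mem_spanMod 3 A v 3
  have m4 : (if 3 ∣ f then θ * δ else δ) ∈ spanMod 3 A v := apply_mem_spanMod 3 A v 4
  have hpair : spanMod 3 A ![w, w * θ] ≤ spanMod 3 A v :=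
    spanMod_le (Fin.forall_fin_two.2 ⟨m2, m3⟩) fun x hx => mul_mem_spanMod _ _ _ hx
  have hef' := hpair hef
  have hcancel : ∀ (c : ℤ) (x : R), ¬ 3 ∣ c → x ∈ A → c * x ∈ spanMod 3 A v →
      x ∈ spanMod 3 A v := by
    intro c x hc hx h
    obtain ⟨r, s, hrs⟩ := ((Int.prime_three.coprime_iff_not_dvd).2 hc)
    have hrs' : (r * 3 + s * c : R) = 1 := by exact_mod_cast congrArg (Int.cast (R := R)) hrs
    have : x = s • (c * x) + (3 : ℤ) * (r * x) := by
      rw [zsmul_eq_mul]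
      push_cast
      linear_combination -x * hrs'
    rw [this]
    exact Submodule.add_mem _ (Submodule.smul_mem _ _ h)
      (mul_mem_spanMod _ _ _ (A.mul_mem (intCast_mem A r) hx))
  have h3mem : ∀ (c : ℤ) (x : R), 3 ∣ c → x ∈ A → c * x ∈ spanMod 3 A v := by
    rintro _ x ⟨c, rfl⟩ hx
    rw [Int.cast_mul, mul_assoc]
    exact mul_mem_spanMod _ _ _ (A.mul_mem (intCast_mem A c) hx)
  by_cases hf : 3 ∣ f
  · have m4' : θ * δ ∈ spanMod 3 A v := by simpa [hf] using m4
    refine hspan v m0 m1 m2 m3 (hcancel e δ (fun he => hcon ⟨he, hf⟩) hδA ?_) m4'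
    exact (Submodule.add_mem_iff_left _ (h3mem f _ hf (A.mul_mem hθ hδA))).1 hef'
  · have m4' : δ ∈ spanMod 3 A v := by simpa [hf] using m4
    refine hspan v m0 m1 m2 m3 m4' (hcancel f _ hf (A.mul_mem hθ hδA) ?_)
    refine (Submodule.add_mem_iff_right _ ?_).1 hef'
    simpa using Submodule.smul_mem _ e m4'
theorem exists_pow_three_sub_eq {θ w δ g : R} (hw : w = θ ^ 2 - 1)
    (hg : g ∈ Algebra.adjoin ℤ {θ, δ}) (hδ2 : δ ^ 2 = -(1 + w) * δ + w * g) :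
    ∀ s ∈ ({θ, δ} : Set R), ∃ y ∈ Algebra.adjoin ℤ {θ, δ}, ∃ z ∈ Algebra.adjoin ℤ {θ, δ},
      s ^ 3 ^ 1 - s = (3 : ℕ) * y + w * z := by
  have hθ : θ ∈ Algebra.adjoin ℤ {θ, δ} := Algebra.subset_adjoin (by simp)
  have hδA : δ ∈ Algebra.adjoin ℤ {θ, δ} := Algebra.subset_adjoin (by simp)
  generalize Algebra.adjoin ℤ {θ, δ} = A at *
  rintro s (rfl | rfl)
  · exact ⟨0, zero_mem _, s, hθ, by rw [hw]; push_cast; ring⟩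
  · refine ⟨0, zero_mem _, (g - s) * (s - 1), A.mul_mem (A.sub_mem hg hδA)
      (A.sub_mem hδA A.one_mem), ?_⟩
    push_cast
    linear_combination (s - 1) * hδ2

/-- The quotient `R / ℤ[θ, δ]` has no `3`-torsion. -/
theorem mem_of_three_mul_mem [IsDomain R] [CharZero R] [Module.Finite ℤ R]
    {θ w δ g : R} (hw : w = θ ^ 2 - 1) (hδ : 3 * δ = w ^ 2)
    (hg : g ∈ Algebra.adjoin ℤ {θ, δ}) (hwδ : w * δ = 3 * g - 3 * δ - w)
    (hδ2 : δ ^ 2 = -(1 + w) * δ + w * g) {n : ℕ} (hn : n ≠ 0)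
    (hnA : ∀ x : R, (n : R) * x ∈ Algebra.adjoin ℤ {θ, δ}) (hrank : 5 < Module.finrank ℤ R)
    {x : R} (hx : ((3 : ℕ) : R) * x ∈ Algebra.adjoin ℤ {θ, δ}) :
    x ∈ Algebra.adjoin ℤ {θ, δ} := by
  have hθ : θ ∈ Algebra.adjoin ℤ {θ, δ} := Algebra.subset_adjoin (by simp)
  have hδA : δ ∈ Algebra.adjoin ℤ {θ, δ} := Algebra.subset_adjoin (by simp)
  have hwA : w ∈ Algebra.adjoin ℤ {θ, δ} :=
    hw ▸ Subalgebra.sub_mem _ (Subalgebra.pow_mem _ hθ 2) (Subalgebra.one_mem _)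
  have hwmul := fun x => mul_mem_spanMod_pair (x := x) hw hδ hg hwδ
  have hindep := fun e f => three_dvd_of_mem_spanMod (e := e) (f := f) hw hδ hg hwδ hδ2 hn hnA hrank
  have hpow := fun x y k => @exists_eq_of_pow_eq R _ {θ, δ} 3 Nat.prime_three 1 one_ne_zero w
    hwA (exists_pow_three_sub_eq hw hg hδ2) x y 0 k
  generalize Algebra.adjoin ℤ {θ, δ} = A at *
  have hnil : ∀ x : R, (3 : ℕ) * x ∈ A → (3 : ℕ) * x ∈ spanMod 3 A ![w, w * θ] := by
    intro x hx
    obtain ⟨k, y, hy, hxy⟩ := exists_pow_eq_prime_mul hn hnA Nat.prime_three hx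
    obtain ⟨y, hy, z, hz, h⟩ := hpow _ _ _ hx hy (zero_mem _) (hxy.trans (by simp))
    rw [h]
    exact Submodule.add_mem _ (by simpa using mul_mem_spanMod 3 A ![w, w * θ] hy) (hwmul z hz)
  obtain ⟨c, d, y, hy, hxy⟩ := mem_spanMod_pair.1 (hnil x hx)
  push_cast at hxy
  have h3 : (3 : R) ≠ 0 := by norm_num
  -- squaring `x - y = w (c + d θ) / 3` turns `w ^ 2 / 9` into `δ / 3`
  have hsq : 3 * (x - y) ^ 2 = δ * (c + d * θ) ^ 2 := by
    apply mul_left_cancel₀ h3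
    linear_combination (3 * x - 3 * y + w * (c + d * θ)) * hxy - (c + d * θ) ^ 2 * hδ
  have hcA : (c + d * θ : R) ∈ A :=
    A.add_mem (intCast_mem A c) (A.mul_mem (intCast_mem A d) hθ)
  have hmem : (((c ^ 2 + d ^ 2 : ℤ) : R) * δ + ((2 * c * d : ℤ) : R) * (θ * δ)) ∈
      spanMod 3 A ![w, w * θ] := by
    have h1 := hnil ((x - y) ^ 2) (by
      push_cast
      rw [hsq]
      exact A.mul_mem hδA (A.pow_mem hcA 2))
    have h2 := hwmul _ (A.mul_mem (intCast_mem A (d ^ 2)) hδA)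
    convert Submodule.sub_mem _ h1 h2 using 1
    push_cast
    rw [hsq, hw]
    ring
  obtain ⟨he, hf⟩ := hindep _ _ hmem
  have hcd : 3 ∣ c ∧ 3 ∣ d := by
    have h2 : (3 : ℤ) ∣ c * d := by
      rw [mul_assoc] at hf
      exact (Int.prime_three.dvd_mul.1 hf).resolve_left (by decide)
    rcases Int.prime_three.dvd_mul.1 h2 with h | h
    · exact ⟨h, Int.prime_three.dvd_of_dvd_pow
        ((dvd_add_right (dvd_pow h two_ne_zero)).1 he)⟩
    · exact ⟨Int.prime_three.dvd_of_dvd_pow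
        ((dvd_add_left (dvd_pow h two_ne_zero)).1 he), h⟩
  obtain ⟨⟨c, rfl⟩, ⟨d, rfl⟩⟩ := hcd
  have : x = w * (c + d * θ) + y := by
    apply mul_left_cancel₀ h3
    push_cast at hxy
    linear_combination hxy
  rw [this]
  exact A.add_mem (A.mul_mem hwA
    (A.add_mem (intCast_mem A c) (A.mul_mem (intCast_mem A d) hθ))) hy

/-- Every `t` in `R` satisfies `t ^ 3 - t ∈ (3, w)`, and `(3, w) / 3 R` has dimension at most `2`,
so if a single element generates `R / 3 R`, the dimension of that ring is at most `3 + 2`. -/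
theorem finrank_le_five_of_three [IsDomain R] [CharZero R] [Module.Finite ℤ R]
    {θ w δ g η : R} (hw : w = θ ^ 2 - 1) (hδ : 3 * δ = w ^ 2) (hg : g ∈ Algebra.adjoin ℤ {θ})
    (hwδ : w * δ = 3 * g - 3 * δ - w) (hδ2 : δ ^ 2 = -(1 + w) * δ + w * g)
    {n : ℕ} (hn : n ≠ 0) (hA : ∀ x : R, (n : R) * x ∈ Algebra.adjoin ℤ {θ})
    (hη : ∀ x, ∃ y ∈ Algebra.adjoin ℤ {η}, ∃ z, x = y + (3 : ℤ) * z) :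
    Module.finrank ℤ R ≤ 5 := by
  by_contra! hrank
  have hθA : Algebra.adjoin ℤ {θ} ≤ Algebra.adjoin ℤ {θ, δ} := Algebra.adjoin_mono (by simp)
  have hgA := hθA hg
  have hnA : ∀ x : R, (n : R) * x ∈ Algebra.adjoin ℤ {θ, δ} := fun x => hθA (hA x)
  have hθ : θ ∈ Algebra.adjoin ℤ {θ, δ} := Algebra.subset_adjoin (by simp)
  have hδA : δ ∈ Algebra.adjoin ℤ {θ, δ} := Algebra.subset_adjoin (by simp)
  have hwmul := fun x => mul_mem_spanMod_pair (x := x) hw hδ hgA hwδ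
  have hsat := fun x => mem_of_three_mul_mem (x := x) hw hδ hgA hwδ hδ2 hn hnA hrank
  have hfrob := fun x I h => @pow_sub_mem_of_mem_adjoin R _ {θ, δ} I 3 Nat.prime_three h 1
    (x := x)
  have hgen := exists_pow_three_sub_eq hw hgA hδ2
  generalize Algebra.adjoin ℤ {θ, δ} = A at *
  have hdec := exists_eq_add_mul_of_saturated hn hnA Nat.prime_three hsat
  set v : Fin 5 → R := ![1, η, η ^ 2, w, w * θ] with hv
  have hp : spanMod 3 A ![w, w * θ] ≤ spanMod 3 ⊤ v := by
    exact spanMod_le (Fin.forall_fin_two.2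
      ⟨apply_mem_spanMod 3 ⊤ v 3, apply_mem_spanMod 3 ⊤ v 4⟩)
      fun x _ => mul_mem_spanMod _ _ _ Algebra.mem_top
  have hwx : ∀ x : R, w * x ∈ spanMod 3 ⊤ v := by
    intro x
    obtain ⟨y, hy, z, rfl⟩ := hdec x
    rw [mul_add, mul_left_comm]
    exact Submodule.add_mem _ (hp (hwmul y hy)) (mul_mem_spanMod 3 ⊤ v Algebra.mem_top)
  have hfix : ∀ x : R, x ^ 3 - x ∈ spanMod 3 ⊤ v := by
    intro x
    let I : Ideal R := Ideal.span {((3 : ℕ) : R), w}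
    have hI : ∀ {t : R}, t ∈ I ↔ ∃ a b, a * ((3 : ℕ) : R) + b * w = t := Ideal.mem_span_pair
    have h3 : ((3 : ℕ) : R) ∈ I := Ideal.subset_span (by simp)
    have hx : x ∈ I.frobeniusFixed Nat.prime_three h3 1 := by
      obtain ⟨y, hy, z, rfl⟩ := hdec x
      refine add_mem (hfrob _ I h3 (fun s hs => ?_) hy)
        (Ideal.le_frobeniusFixed (Ideal.mul_mem_right _ _ (by simpa using h3)))
      obtain ⟨y, -, z, -, h⟩ := hgen s hs
      exact hI.2 ⟨y, z, by rw [h]; ring⟩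
    obtain ⟨a, b, hab⟩ := hI.1 (Ideal.mem_frobeniusFixed.1 hx)
    have h : x ^ 3 - x = (3 : ℤ) * a + w * b := by push_cast at hab ⊢; linear_combination -hab
    rw [h]
    exact Submodule.add_mem _ (mul_mem_spanMod 3 ⊤ v Algebra.mem_top) (hwx b)
  refine hrank.not_ge (finrank_le_of_spanMod_adjoin_singleton Nat.prime_three hη (v := v)
    (apply_mem_spanMod 3 ⊤ v 0) fun i => ?_)
  have e0 : η * 1 ∈ spanMod 3 ⊤ v := (mul_one η).symm ▸ apply_mem_spanMod 3 ⊤ v 1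
  have e1 : η * η ∈ spanMod 3 ⊤ v := sq η ▸ apply_mem_spanMod 3 ⊤ v 2
  have e2 : η * η ^ 2 ∈ spanMod 3 ⊤ v := by
    rw [show η * η ^ 2 = (η ^ 3 - η) + η by ring]
    exact Submodule.add_mem _ (hfix η) (apply_mem_spanMod 3 ⊤ v 1)
  have e3 : η * w ∈ spanMod 3 ⊤ v := mul_comm w η ▸ hwx η
  have e4 : η * (w * θ) ∈ spanMod 3 ⊤ v := by
    rw [mul_left_comm]
    exact hwx _
  fin_cases i
  exacts [e0, e1, e2, e3, e4]

end

/-! ### The sextic field -/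

namespace NumberField
variable {K : Type*} [Field K] [NumberField K]

theorem exists_ringOfIntegers_eq_of_quadratic {x : K} {u v : 𝓞 K}
    (h : x ^ 2 + (u : K) * x + (v : K) = 0) : ∃ y : 𝓞 K, (y : K) = x := by
  have h1 : IsIntegral (𝓞 K) x := by
    refine ⟨X ^ 2 + C u * X + C v, by monicity!, ?_⟩
    simpa using h
  exact IsIntegrallyClosed.isIntegral_iff.1 h1

/-- The multiplier is the numerator of the discriminant of the power basis of `θ`. -/
theorem exists_mul_mem_adjoin {θ : 𝓞 K} (hθ : ℚ⟮(θ : K)⟯ = ⊤) :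
    ∃ n : ℕ, n ≠ 0 ∧ ∀ x : 𝓞 K, (n : 𝓞 K) * x ∈ Algebra.adjoin ℤ {θ} := by
  have hint : IsIntegral ℤ (θ : K) := RingOfIntegers.isIntegral_coe θ
  have hintQ : IsIntegral ℚ (θ : K) := hint.tower_top
  have htop : Algebra.adjoin ℚ {(θ : K)} = ⊤ := by
    rw [← IntermediateField.adjoin_simple_toSubalgebra_of_isAlgebraic hintQ.isAlgebraic, hθ,
      IntermediateField.top_toSubalgebra]
  let B := PowerBasis.ofAdjoinEqTop hintQ htop
  have hB : B.gen = (θ : K) := PowerBasis.ofAdjoinEqTop_gen hintQ htop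
  set q := Algebra.discr ℚ B.basis with hq
  have hq0 : q ≠ 0 := Algebra.discr_not_zero_of_basis ℚ B.basis
  refine ⟨q.num.natAbs, by simpa using hq0, fun x => ?_⟩
  have h1 : q • (x : K) ∈ Algebra.adjoin ℤ {(θ : K)} := by
    have := Algebra.discr_mul_isIntegral_mem_adjoin ℚ (B := B) (by rwa [hB])
      (RingOfIntegers.isIntegral_coe x)
    rwa [hB] at this
  have h2 : ((q.num : 𝓞 K) * x : 𝓞 K) ∈ Algebra.adjoin ℤ {θ} := by
    have h3 : (q.num : K) * (x : K) ∈ Algebra.adjoin ℤ {(θ : K)} := by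
      have h4 : (q.num : K) * (x : K) = (q.den : K) * (q • (x : K)) := by
        rw [Rat.smul_def, ← mul_assoc]
        congr 1
        exact_mod_cast (Rat.den_mul_eq_num q).symm
      rw [h4]
      exact Subalgebra.mul_mem _ (natCast_mem _ _) h1
    have hmap : Algebra.adjoin ℤ {(θ : K)} =
        (Algebra.adjoin ℤ {θ}).map (Algebra.algHom ℤ (𝓞 K) K) := by
      rw [AlgHom.map_adjoin, Set.image_singleton]
      rfl
    rw [hmap] at h3
    obtain ⟨y, hy, hyx⟩ := h3
    have : y = (q.num : 𝓞 K) * x := by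
      apply RingOfIntegers.coe_injective
      rw [map_mul, map_intCast]
      exact hyx
    exact this ▸ hy
  rcases Int.natAbs_eq q.num with h | h
  · rw [h] at h2
    simpa using h2
  · rw [h] at h2
    simpa using h2

/-- An infinite index is `0` by convention, hence divisible by `p`; so the index is finite here, and
prime to `p`. -/
theorem exists_eq_add_mul_of_not_dvd_elementIndex {p : ℕ} (hp : p.Prime) {η : 𝓞 K}
    (h : ¬ p ∣ elementIndex K η) (x : 𝓞 K) :
    ∃ y ∈ Algebra.adjoin ℤ {η}, ∃ z, x = y + (p : ℤ) * z := by
  refine exists_eq_add_mul_of_isCoprime (n := elementIndex K η)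
    (Nat.isCoprime_iff_coprime.2 (hp.coprime_iff_not_dvd.2 h).symm) ?_
  have := (Subalgebra.toSubmodule (Algebra.adjoin ℤ {η})).toAddSubgroup.nsmul_index_mem x
  rw [nsmul_eq_mul] at this
  exact_mod_cast this

theorem IsMonogenic.exists_elementIndex_eq_one (h : IsMonogenic K) :
    ∃ α : 𝓞 K, elementIndex K α = 1 := by
  obtain ⟨α, B, hB⟩ := h
  refine ⟨α, ?_⟩
  have htop : Subalgebra.toSubmodule (Algebra.adjoin ℤ {α}) = ⊤ := by
    rw [eq_top_iff, ← B.span_eq, Submodule.span_le]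
    rintro _ ⟨i, rfl⟩
    rw [hB]
    exact Subalgebra.pow_mem _ (Algebra.self_mem_adjoin_singleton ℤ α) _
  rw [elementIndex, htop]
  exact AddSubgroup.index_top

section
variable {a b : ℤ} {m : ℕ} {θ : 𝓞 K}

theorem two_dvd_elementIndex (hθ : θ ^ 6 + a * θ ^ m + b = 0) (hgen : ℚ⟮(θ : K)⟯ = ⊤)
    (hrank : Module.finrank ℤ (𝓞 K) = 6) (ha : a ≡ 0 [ZMOD 8]) (hb : b ≡ -1 [ZMOD 4])
    (η : 𝓞 K) : 2 ∣ elementIndex K η := by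
  by_contra hη
  obtain ⟨n, hn, hnA⟩ := exists_mul_mem_adjoin hgen
  obtain ⟨a', rfl⟩ := Int.modEq_zero_iff_dvd.1 ha
  obtain ⟨c, hc⟩ := hb.dvd
  obtain rfl : b = -1 - 4 * c := by linarith
  -- `γ ^ 2 + γ = (θ ^ 6 - 1) / 4` lies in `ℤ[θ]` because `4 ∣ b + 1` and `4 ∣ a`;
  -- that `8 ∣ a` makes the term in `θ ^ m` even
  obtain ⟨γ, hγ⟩ := exists_ringOfIntegers_eq_of_quadratic (x := ((θ : K) ^ 3 - 1) / 2) (u := 1)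
    (v := -((c : 𝓞 K) - 2 * ((a' : 𝓞 K) * θ ^ m))) (by
      have := congrArg (algebraMap (𝓞 K) K) hθ
      push_cast [map_add, map_mul, map_pow, map_sub, map_neg, map_zero, map_one, map_ofNat,
        map_intCast] at this ⊢
      linear_combination this / 4)
  have h1 : 2 * γ + 1 = θ ^ 3 := by
    apply RingOfIntegers.coe_injective
    push_cast [map_add, map_mul, map_pow, map_one, map_ofNat]
    linear_combination 2 * hγ
  have h2 : γ ^ 2 = -γ + c + 2 * (-(a' * θ ^ m)) := by
    have h4 : (4 : 𝓞 K) ≠ 0 := by norm_num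
    apply mul_left_cancel₀ h4
    push_cast at hθ
    linear_combination hθ + (2 * γ + 1 + θ ^ 3) * h1
  have hg : (-(a' * θ ^ m) : 𝓞 K) ∈ Algebra.adjoin ℤ {θ} :=
    neg_mem (mul_mem (intCast_mem _ _) (pow_mem (Algebra.self_mem_adjoin_singleton ℤ θ) _))
  have := finrank_le_four_of_two h1 hg h2 hn hnA
    (exists_eq_add_mul_of_not_dvd_elementIndex Nat.prime_two hη)
  omega

theorem three_dvd_elementIndex (hθ : θ ^ 6 + a * θ ^ m + b = 0) (hgen : ℚ⟮(θ : K)⟯ = ⊤)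
    (hrank : Module.finrank ℤ (𝓞 K) = 6) (ha : a ≡ 0 [ZMOD 9]) (hb : b ≡ -1 [ZMOD 9])
    (η : 𝓞 K) : 3 ∣ elementIndex K η := by
  by_contra hη
  obtain ⟨n, hn, hnA⟩ := exists_mul_mem_adjoin hgen
  obtain ⟨a', rfl⟩ := Int.modEq_zero_iff_dvd.1 ha
  obtain ⟨c, hc⟩ := hb.dvd
  obtain rfl : b = -1 - 9 * c := by linarith
  obtain ⟨g, hgdef⟩ : ∃ g : 𝓞 K, g = c - a' * θ ^ m := ⟨_, rfl⟩
  obtain ⟨w, hw⟩ : ∃ w : 𝓞 K, w = θ ^ 2 - 1 := ⟨_, rfl⟩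
  -- this is `(θ ^ 2) ^ 3 = 1 + 9 g` in terms of `w = θ ^ 2 - 1`
  have hw3 : w ^ 3 + 3 * w ^ 2 + 3 * w = 9 * g := by
    rw [hgdef, hw]
    push_cast at hθ
    linear_combination hθ
  obtain ⟨δ, hδ'⟩ := exists_ringOfIntegers_eq_of_quadratic (x := (w : K) ^ 2 / 3) (u := 1 + w)
    (v := -(w * g)) (by
      have := congrArg (algebraMap (𝓞 K) K) hw3
      push_cast [map_add, map_mul, map_pow, map_sub, map_neg, map_zero, map_one, map_ofNat,
        map_intCast] at this ⊢
      linear_combination (w : K) * this / 9)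
  have hδ : 3 * δ = w ^ 2 := by
    apply RingOfIntegers.coe_injective
    push_cast [map_mul, map_pow, map_ofNat]
    linear_combination 3 * hδ'
  have h3 : (3 : 𝓞 K) ≠ 0 := by norm_num
  have hwδ : w * δ = 3 * g - 3 * δ - w := by
    apply mul_left_cancel₀ h3
    linear_combination hw3 + (w + 3) * hδ
  have hδ2 : δ ^ 2 = -(1 + w) * δ + w * g := by
    apply mul_left_cancel₀ h3
    linear_combination δ * hδ + w * hwδ + hδ
  have hg : g ∈ Algebra.adjoin ℤ {θ} := hgdef ▸ sub_mem (intCast_mem _ _)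
    (mul_mem (intCast_mem _ _) (pow_mem (Algebra.self_mem_adjoin_singleton ℤ θ) _))
  have := finrank_le_five_of_three hw hδ hg hwδ hδ2 hn hnA
    (exists_eq_add_mul_of_not_dvd_elementIndex Nat.prime_three hη)
  omega

end

end NumberField

theorem theorem2p3 (K : Type*) [Field K] [NumberField K] (a b : ℤ) (m : ℕ) (hm : m ≤ 5)
    (hirr : Irreducible (X ^ 6 + C a * X ^ m + C b : ℤ[X]))
    (θ : K) (hroot : aeval θ (X ^ 6 + C a * X ^ m + C b : ℤ[X]) = 0) (hgen : ℚ⟮θ⟯ = ⊤) :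
    (a ≡ 0 [ZMOD 9] → b ≡ -1 [ZMOD 9] → 3 ∣ NumberField.fieldIndex K) ∧
    (a ≡ 0 [ZMOD 8] → b ≡ -1 [ZMOD 4] → 2 ∣ NumberField.fieldIndex K) ∧
    ((a ≡ 0 [ZMOD 9] ∧ b ≡ -1 [ZMOD 9]) ∨ (a ≡ 0 [ZMOD 8] ∧ b ≡ -1 [ZMOD 4]) →
      ¬ NumberField.IsMonogenic K) := by
  have hdeg : (C a * X ^ m + C b : ℤ[X]).degree < (6 : ℕ) := by
    refine (degree_add_le _ _).trans_lt (max_lt ?_ ?_)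
    · exact (degree_C_mul_X_pow_le m a).trans_lt (by exact_mod_cast Nat.lt_succ_of_le hm)
    · exact degree_C_le.trans_lt (by norm_num)
  have hmonic : (X ^ 6 + C a * X ^ m + C b : ℤ[X]).Monic := by
    rw [add_assoc]
    exact monic_X_pow_add hdeg
  have hnat : (X ^ 6 + C a * X ^ m + C b : ℤ[X]).natDegree = 6 := by
    rw [add_assoc, natDegree_eq_of_degree_eq_some]
    rw [degree_add_eq_left_of_degree_lt (by rwa [degree_X_pow]), degree_X_pow]
  have hintθ : IsIntegral ℤ θ := ⟨_, hmonic, hroot⟩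
  have hmin : minpoly ℚ θ = (X ^ 6 + C a * X ^ m + C b : ℤ[X]).map (algebraMap ℤ ℚ) :=
    (minpoly.eq_of_irreducible_of_monic
      (hmonic.irreducible_iff_irreducible_map_fraction_map.1 hirr)
      (by rw [aeval_map_algebraMap]; exact hroot) (hmonic.map _)).symm
  have hrank : Module.finrank ℤ (𝓞 K) = 6 := by
    rw [RingOfIntegers.rank, ← IntermediateField.finrank_top', ← hgen,
      IntermediateField.adjoin.finrank hintθ.tower_top, hmin, hmonic.natDegree_map, hnat]
  obtain ⟨θ, rfl⟩ : ∃ t : 𝓞 K, (t : K) = θ := ⟨⟨θ, hintθ⟩, rfl⟩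
  have hθ : θ ^ 6 + a * θ ^ m + b = 0 := by
    apply RingOfIntegers.coe_injective
    simpa using hroot
  have h3 : a ≡ 0 [ZMOD 9] → b ≡ -1 [ZMOD 9] → ∀ η, 3 ∣ elementIndex K η :=
    fun ha hb => three_dvd_elementIndex hθ hgen hrank ha hb
  have h2 : a ≡ 0 [ZMOD 8] → b ≡ -1 [ZMOD 4] → ∀ η, 2 ∣ elementIndex K η :=
    fun ha hb => two_dvd_elementIndex hθ hgen hrank ha hb
  refine ⟨fun ha hb => (dvd_fieldIndex_iff K 3).2 fun η _ => h3 ha hb η,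
    fun ha hb => (dvd_fieldIndex_iff K 2).2 fun η _ => h2 ha hb η, fun h hmono => ?_⟩
  obtain ⟨α, hα⟩ := hmono.exists_elementIndex_eq_one
  rcases h with ⟨ha, hb⟩ | ⟨ha, hb⟩
  · have := h3 ha hb α
    omega
  · have := h2 ha hb α
    omega
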